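/- For a connected simple graph $G$ with vertices $v_1,\dots,v_n$, let $D(G)=(d_G(v_i,v_j))_{i,j}$ be its distance matrix, let $\mathrm{Tr}(G)$ be the diagonal matrix whose $i$-th diagonal entry is $\sum_j d_G(v_i,v_j)$, and let $\eta(G)$ be the largest eigenvalue of $Q(G)=\mathrm{Tr}(G)+D(G)$. Say that $G$ has a $\{K_2,\{C_k\}\}$-factor if $G$ has a spanning subgraph each of whose connected components is isomorphic to $K_2$ or to a cycle $C_k$ for some integer $k\ge 3$ (different components may be cycles of different lengths). Write $H_1+H_2$ for the disjoint union, $H_1\vee H_2$ for the join and $\overline{H}$ for the complement. Let $G$ be a connected simple graph of order $n$. (1) Suppose $n\ge 16$, $n=12$ or $n=14$. If $\eta(G)\le \eta\bigl(K_1\vee(K_{n-3}+\overline{K_2})\bigr)$, then $G$ has a $\{K_2,\{C_k\}\}$-factor unless $G\cong K_1\vee(K_{n-3}+\overline{K_2})$. (2) Suppose $3\le n\le 11$, $n=13$ or $n=15$, and let $\widehat G=K_{\lfloor (n-1)/2\rfloor}\vee\overline{K_{\lceil (n+1)/2\rceil}}$, that is, $\widehat G=K_{(n-1)/2}\vee\overline{K_{(n+1)/2}}$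 for odd $n$ and $\widehat G=K_{n/2-1}\vee\overline{K_{n/2+1}}$ for even $n$. If $\eta(G)\le\eta(\widehat G)$, then $G$ has a $\{K_2,\{C_k\}\}$-factor unless $G\cong\widehat G$. -/

import Mathlib

namespace DistanceSignless

open SimpleGraph

/-- The transmission of a vertex: the sum of its distances to all vertices. -/
noncomputable def transmission {V : Type*} [Fintype V] (G : SimpleGraph V) (v : V) : ℝ :=
  ∑ w, (G.dist v w : ℝ)

/-- The distance matrix `D(G)`. -/
noncomputable def distMatrix {V : Type*} (G : SimpleGraph V) : Matrix V V ℝ :=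
  Matrix.of fun v w => (G.dist v w : ℝ)

/-- The distance signless Laplacian matrix `Q(G) = Tr(G) + D(G)`. -/
noncomputable def distSignlessLaplacian {V : Type*} [Fintype V] [DecidableEq V]
    (G : SimpleGraph V) : Matrix V V ℝ :=
  Matrix.diagonal (transmission G) + distMatrix G

/-- The distance signless Laplacian spectral radius `η(G)`: the largest eigenvalue of `Q(G)`
(for the fact that the supremum is attained, see `isGreatest_eta`). -/
noncomputable def eta {V : Type*} [Fintype V] [DecidableEq V] (G : SimpleGraph V) : ℝ :=
  sSup (spectrum ℝ (distSignlessLaplacian G))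

theorem distSignlessLaplacian_isHermitian {V : Type*} [Fintype V] [DecidableEq V]
    (G : SimpleGraph V) : (distSignlessLaplacian G).IsHermitian := by
  refine (Matrix.isHermitian_diagonal _).add ?_
  ext v w
  simp [distMatrix, SimpleGraph.dist_comm]

theorem isGreatest_eta {V : Type*} [Fintype V] [DecidableEq V] [Nonempty V]
    (G : SimpleGraph V) :
    IsGreatest (spectrum ℝ (distSignlessLaplacian G)) (eta G) := by
  have hfin : (spectrum ℝ (distSignlessLaplacian G)).Finite := Matrix.finite_real_spectrum
  have hne : (spectrum ℝ (distSignlessLaplacian G)).Nonempty :=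
    ⟨_, (distSignlessLaplacian_isHermitian G).eigenvalues_mem_spectrum_real
      (Classical.arbitrary V)⟩
  exact ⟨hne.csSup_mem hfin, fun x hx => le_csSup hfin.bddAbove hx⟩

/-- The join `G ∨ H`: the disjoint union of `G` and `H` together with all edges between them. -/
def join {V W : Type*} (G : SimpleGraph V) (H : SimpleGraph W) : SimpleGraph (V ⊕ W) :=
  (G ⊕g H) ⊔ completeBipartiteGraph V W

/-- `K_1 ∨ (K_{n-3} + \overline{K_2})`, a graph of order `n` for `n ≥ 3`. -/
def oneJoin (n : ℕ) : SimpleGraph (Fin 1 ⊕ (Fin (n - 3) ⊕ Fin 2)) :=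
  join (completeGraph (Fin 1)) (completeGraph (Fin (n - 3)) ⊕g (completeGraph (Fin 2))ᶜ)

/-- `K_{⌊(n-1)/2⌋} ∨ \overline{K_{⌈(n+1)/2⌉}}`, a graph of order `n` for `n ≥ 1`. In natural-number
division, `(n - 1) / 2` and `n / 2 + 1` are `(n-1)/2` and `(n+1)/2` if `n` is odd, and they are
`n/2 - 1` and `n/2 + 1` if `n ≥ 2` is even. -/
def halfJoin (n : ℕ) : SimpleGraph (Fin ((n - 1) / 2) ⊕ Fin (n / 2 + 1)) :=
  join (completeGraph (Fin ((n - 1) / 2))) (completeGraph (Fin (n / 2 + 1)))ᶜ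

/-- `G` has an `𝓗`-factor, for a family `𝓗` of finite graphs: there is a spanning subgraph `F`
of `G` (a graph on the same vertex set with `F ≤ G`) each of whose connected components is
isomorphic to a member of `𝓗`. -/
def HasFactor {V : Type*} (G : SimpleGraph V) (𝓗 : Set (Σ m : ℕ, SimpleGraph (Fin m))) : Prop :=
  ∃ F : SimpleGraph V, F ≤ G ∧
    ∀ c : F.ConnectedComponent, ∃ H ∈ 𝓗, Nonempty (c.toSimpleGraph ≃g H.2)

/-- The family `{K_2, {C_k}}`: the complete graph `K_2` and all cycles `C_k`, `k ≥ 3`. -/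
def edgeOrCycles : Set (Σ m : ℕ, SimpleGraph (Fin m)) :=
  {⟨2, completeGraph (Fin 2)⟩} ∪ {H | ∃ k : ℕ, 3 ≤ k ∧ H = ⟨k, cycleGraph k⟩}

end DistanceSignless

/-!
A permutation `f` of the vertices with `v` adjacent to `f v` for all `v` splits the graph into
edges (the 2-cycles of `f`) and cycles. By Hall's theorem such an `f` exists unless some
independent set `I` has fewer than `|I|` neighbours; shrinking `I`, one may take `|I| = s + 1` where
`s` is the number of its neighbours. So a connected graph of order `n` without a factor is a
spanning subgraph of `K_s ∨ (K_{n-2s-1} + \overline{K_{s+1}})` for some `1 ≤ s ≤ (n - 1) / 2`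
(`exists_isDeficient_of_not_hasFactor`). The graph `oneJoin n` is the case `s = 1`, and `halfJoin n`
is the case of the largest `s`.

All spectral comparisons come from pairing the positive Perron eigenvector of `Q(G)`
(`exists_pos_eigenvector_eta`) with a test vector `w`: the sign of `Q w - θ w` decides that of
`η - θ`. This yields that `η` strictly decreases when edges are added (`eta_lt_of_lt`), and, with a
test vector that is constant on the three parts, that `θ - η` has the sign of an explicit polynomial
`quotientPoly n s t`, where `t = θ - (2 * n - 2) ≥ 0` (`IsDeficient.eta_sub_mul`).

For fixed `n` and `t` that polynomial is strictly convex in `s` on `[0, n / 2]`. Hence, if it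
vanishes at one end of the range of `s` for `θ` equal to the `η` of the extremal graph, and is
negative at the other end, then it is negative at every other `s`, so all the other graphs of the
family have a larger `η`. At the right end the polynomial factors (`quotientPoly_half`), which leaves
elementary inequalities in `n` and `t`.
-/

namespace DistanceSignless

open SimpleGraph

/-! ### Factors from permutations -/

theorem sub_mod_eq_one_iff {k i j : ℕ} (hk : 2 ≤ k) (hi : i < k) (hj : j < k) :
    (k - j + i) % k = 1 ↔ (j + 1) % k = i := by
  have key : ∀ m, m < 2 * k → m % k = if m < k then m else m - k := by
    intro m hm
    split_ifs with h
    · exact Nat.mod_eq_of_lt h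
    · rw [Nat.mod_eq_sub_mod (by omega), Nat.mod_eq_of_lt (by omega)]
  rw [key _ (by omega), key _ (by omega)]
  split_ifs <;> omega

/-- The graph of a self-map: `u` and `f u` are joined whenever they differ. -/
def mapGraph {V : Type*} (f : V → V) : SimpleGraph V :=
  SimpleGraph.fromRel fun u v => f u = v

theorem mapGraph_reachable_iterate {V : Type*} (f : V → V) (u : V) (i : ℕ) :
    (mapGraph f).Reachable u (f^[i] u) := by
  induction i with
  | zero => exact Reachable.refl _
  | succ i ih =>
    refine ih.trans ?_
    rw [Function.iterate_succ_apply']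
    by_cases h : f^[i] u = f (f^[i] u)
    · rw [← h]
    · exact Adj.reachable (by simp [mapGraph, h])

theorem exists_iterate_of_mapGraph_reachable {V : Type*} [Finite V] {f : V → V}
    (hf : Function.Injective f) {u v : V} (h : (mapGraph f).Reachable u v) :
    ∃ i, f^[i] u = v := by
  rw [SimpleGraph.reachable_iff_reflTransGen] at h
  induction h with
  | refl => exact ⟨0, rfl⟩
  | @tail w v _ hwv ih =>
    obtain ⟨i, rfl⟩ := ih
    rcases (by simpa [mapGraph] using hwv.2 : f (f^[i] u) = v ∨ f v = f^[i] u) with h | h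
    · exact ⟨i + 1, by rw [Function.iterate_succ_apply', h]⟩
    · -- the predecessor `v` of `f^[i] u` is also a later iterate, since `v` is periodic
      obtain ⟨p, hp, hpv⟩ := hf.mem_periodicPts v
      refine ⟨p - 1 + i, ?_⟩
      rw [Function.iterate_add_apply, ← h, ← Function.iterate_succ_apply,
        show (p - 1).succ = p by omega]
      exact hpv

/-- The components of the graph of a fixed-point-free permutation are its cycles. -/
theorem mapGraph_component_iso {V : Type*} [Finite V] {f : V → V}
    (hf : Function.Injective f) (hne : ∀ v, f v ≠ v) (u : V) :
    2 ≤ Function.minimalPeriod f u ∧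
      Nonempty (((mapGraph f).connectedComponentMk u).toSimpleGraph ≃g
        cycleGraph (Function.minimalPeriod f u)) := by
  set k := Function.minimalPeriod f u with hkdef
  have hk0 : 0 < k := Function.minimalPeriod_pos_of_mem_periodicPts (hf.mem_periodicPts u)
  have hk1 : k ≠ 1 := fun h => hne u (Function.minimalPeriod_eq_one_iff_isFixedPt.1 h)
  have hk : 2 ≤ k := by omega
  refine ⟨hk, ?_⟩
  have hmod : ∀ i j : ℕ, j < k → (f (f^[i] u) = f^[j] u ↔ (i + 1) % k = j) := by
    intro i j hj
    rw [← Function.iterate_succ_apply' f, ← Function.iterate_mod_minimalPeriod_eq]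
    exact Function.iterate_eq_iterate_iff_of_lt_minimalPeriod (Nat.mod_lt _ hk0) hj
  let e : Fin k → ((mapGraph f).connectedComponentMk u) := fun i =>
    ⟨f^[i] u, ConnectedComponent.sound (mapGraph_reachable_iterate f u i).symm⟩
  have he : Function.Bijective e := by
    constructor
    · intro i j hij
      exact Fin.ext ((Function.iterate_eq_iterate_iff_of_lt_minimalPeriod i.2 j.2).1
        (congrArg Subtype.val hij))
    · rintro ⟨v, hv⟩
      obtain ⟨i, rfl⟩ := exists_iterate_of_mapGraph_reachable hf (ConnectedComponent.exact hv).symm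
      exact ⟨⟨i % k, Nat.mod_lt _ hk0⟩, Subtype.ext (Function.iterate_mod_minimalPeriod_eq)⟩
  refine ⟨(RelIso.mk (Equiv.ofBijective e he) ?_ : cycleGraph k ≃g _).symm⟩
  intro i j
  change (mapGraph f).Adj (f^[i] u) (f^[j] u) ↔ _
  have hadj : (mapGraph f).Adj (f^[i] u) (f^[j] u) ↔
      f (f^[i] u) = f^[j] u ∨ f (f^[j] u) = f^[i] u := by
    simp only [mapGraph, fromRel_adj, and_iff_right_iff_imp]
    rintro (h | h) h'
    · exact hne (f^[i] u) (h.trans h'.symm)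
    · exact hne (f^[j] u) (h.trans h')
  rw [hadj, cycleGraph_adj', Fin.sub_def, Fin.sub_def, hmod _ _ j.2, hmod _ _ i.2]
  rw [sub_mod_eq_one_iff hk i.2 j.2, sub_mod_eq_one_iff hk j.2 i.2, or_comm]

/-- A permutation moving every vertex to a neighbour decomposes the graph into edges
(its 2-cycles) and cycles. -/
theorem hasFactor_of_injective {V : Type*} [Finite V] {G : SimpleGraph V} {f : V → V}
    (hf : Function.Injective f) (hadj : ∀ v, G.Adj v (f v)) : HasFactor G edgeOrCycles := by
  refine ⟨mapGraph f, ?_, ?_⟩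
  · rintro u v ⟨-, rfl | rfl⟩
    · exact hadj u
    · exact (hadj v).symm
  · intro c
    induction c using ConnectedComponent.ind with
    | h u =>
      obtain ⟨hk, hiso⟩ := mapGraph_component_iso hf (fun v => (hadj v).ne') u
      rcases hk.eq_or_lt with h2 | h3
      · rw [← h2, cycleGraph_two_eq_top] at hiso
        exact ⟨_, Or.inl rfl, hiso⟩
      · exact ⟨_, Or.inr ⟨_, h3, rfl⟩, hiso⟩

/-- Tutte's criterion: by Hall's theorem for the bipartite double cover, a graph without a
factor into edges and cycles has an independent set with too few neighbours. It may be taken to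
have exactly one vertex more than its set `S` of neighbours. -/
theorem exists_independent_of_not_hasFactor {V : Type*} [Fintype V] [DecidableEq V]
    {G : SimpleGraph V} (h : ¬ HasFactor G edgeOrCycles) :
    ∃ S I : Finset V, Disjoint S I ∧ I.card = S.card + 1 ∧ ∀ u ∈ I, ∀ v, G.Adj u v → v ∈ S := by
  classical
  have hall : ¬ ∀ X : Finset V, X.card ≤ (X.biUnion fun v => G.neighborFinset v).card := by
    intro hX
    obtain ⟨f, hf, hf'⟩ := (Finset.all_card_le_biUnion_card_iff_exists_injective _).1 hX
    exact h (hasFactor_of_injective hf fun v => (G.mem_neighborFinset _ _).1 (hf' v))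
  push Not at hall
  obtain ⟨X, hX⟩ := hall
  set N : Finset V → Finset V := fun X => X.biUnion fun v => G.neighborFinset v with hN
  have memN : ∀ Y v, v ∈ N Y ↔ ∃ u ∈ Y, G.Adj u v := by intro Y v; simp [hN]
  -- the vertices isolated in the subgraph induced on `X`
  set J := X \ N X with hJ
  have hdisj : Disjoint (N J) X := by
    rw [Finset.disjoint_left]
    intro v hv hvX
    obtain ⟨u, hu, huv⟩ := (memN _ _).1 hv
    exact (Finset.mem_sdiff.1 hu).2 ((memN _ _).2 ⟨v, hvX, huv.symm⟩)
  have hcard : (N J).card < J.card := by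
    have h1 : N J ∪ (X ∩ N X) ⊆ N X := by
      refine Finset.union_subset ?_ Finset.inter_subset_right
      exact Finset.biUnion_subset_biUnion_of_subset_left _ Finset.sdiff_subset
    have h2 := Finset.card_le_card h1
    rw [Finset.card_union_of_disjoint (hdisj.mono_right Finset.inter_subset_left)] at h2
    have h3 := Finset.card_sdiff_add_card_inter X (N X)
    change (N X).card < X.card at hX
    rw [← hJ] at h3
    omega
  obtain ⟨I, hI, hIc⟩ := Finset.exists_subset_card_eq (Nat.succ_le_of_lt hcard)
  refine ⟨N J, I, hdisj.mono_right (hI.trans Finset.sdiff_subset), hIc, ?_⟩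
  exact fun u hu v huv => (memN _ _).2 ⟨u, hI hu, huv⟩

/-! ### Perron eigenvectors and monotonicity of `η` -/

section Perron

open Matrix in
/-- Perron's theorem for a symmetric matrix with nonnegative diagonal and positive off-diagonal
entries: passing to absolute values in an eigenvector for the largest eigenvalue does not decrease
the Rayleigh quotient, so it yields an eigenvector again. -/
theorem exists_pos_eigenvector {ι : Type*} [Fintype ι] [DecidableEq ι] {A : Matrix ι ι ℝ}
    (hA : A.IsHermitian) (hdiag : ∀ i, 0 ≤ A i i) (hoff : ∀ i j, i ≠ j → 0 < A i j) {θ : ℝ}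
    (hθ : IsGreatest (spectrum ℝ A) θ) : ∃ v : ι → ℝ, (∀ i, 0 < v i) ∧ A *ᵥ v = θ • v := by
  have hnonneg : ∀ i j, 0 ≤ A i j := fun i j => by
    rcases eq_or_ne i j with rfl | h
    exacts [hdiag i, (hoff i j h).le]
  have hB : (algebraMap ℝ (Matrix ι ι ℝ) θ - A).PosSemidef := by
    refine posSemidef_iff_isHermitian_and_spectrum_nonneg.2 ⟨?_, ?_⟩
    · refine IsHermitian.sub ?_ hA
      rw [Algebra.algebraMap_eq_smul_one]
      ext i j
      simp [Matrix.one_apply, eq_comm]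
    · rw [← spectrum.singleton_sub_eq]
      rintro _ ⟨_, rfl, x, hx, rfl⟩
      exact sub_nonneg.2 (hθ.2 hx)
  have hBv : ∀ v, (algebraMap ℝ (Matrix ι ι ℝ) θ - A) *ᵥ v = θ • v - A *ᵥ v := by
    intro v
    rw [sub_mulVec, Algebra.algebraMap_eq_smul_one, smul_mulVec, one_mulVec]
  obtain ⟨x, hx⟩ : ∃ x, Module.End.HasEigenvector A.toLin' θ x := by
    refine Module.End.HasEigenvalue.exists_hasEigenvector ?_
    rw [Module.End.hasEigenvalue_iff_mem_spectrum, spectrum_toLin']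
    exact hθ.1
  have hAx : A *ᵥ x = θ • x := by simpa using hx.apply_eq_smul
  set v : ι → ℝ := fun i => |x i| with hv
  have hAv : A *ᵥ v = θ • v := by
    have h0 : v ⬝ᵥ ((algebraMap ℝ (Matrix ι ι ℝ) θ - A) *ᵥ v) = 0 := by
      refine le_antisymm ?_ (by simpa using hB.dotProduct_mulVec_nonneg v)
      have h1 : x ⬝ᵥ ((algebraMap ℝ (Matrix ι ι ℝ) θ - A) *ᵥ x) = 0 := by
        rw [hBv, hAx, sub_self, dotProduct_zero]
      rw [hBv, dotProduct_sub] at h1 ⊢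
      have h2 : x ⬝ᵥ A *ᵥ x ≤ v ⬝ᵥ A *ᵥ v := by
        simp only [dotProduct, mulVec, Finset.mul_sum]
        refine Finset.sum_le_sum fun i _ => Finset.sum_le_sum fun j _ => ?_
        calc x i * (A i j * x j) ≤ |x i * (A i j * x j)| := le_abs_self _
          _ = v i * (A i j * v j) := by
            rw [abs_mul, abs_mul, abs_of_nonneg (hnonneg i j)]
      have h3 : x ⬝ᵥ θ • x = v ⬝ᵥ θ • v := by
        simp only [dotProduct, Pi.smul_apply, smul_eq_mul]
        refine Finset.sum_congr rfl fun i _ => ?_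
        rw [mul_left_comm, mul_left_comm (v i), hv, abs_mul_abs_self]
      linarith
    have := (hB.dotProduct_mulVec_zero_iff v).1 (by simpa using h0)
    rw [hBv] at this
    exact (sub_eq_zero.1 this).symm
  refine ⟨v, fun i => (abs_nonneg _).lt_of_ne' fun hi => hx.2 ?_, hAv⟩
  -- a vanishing coordinate forces all the others to vanish, as the off-diagonal is positive
  have hsum : ∑ j, A i j * v j = 0 := by
    have := congrFun hAv i
    simpa [mulVec, dotProduct, hv, hi] using this
  have hz := (Finset.sum_eq_zero_iff_of_nonneg
    fun j _ => mul_nonneg (hnonneg i j) (abs_nonneg (x j))).1 hsum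
  ext j
  rcases eq_or_ne i j with rfl | hij
  · simpa [hv] using hi
  · have := hz j (Finset.mem_univ j)
    simpa [hv, (hoff i j hij).ne'] using this

variable {V : Type*} [Fintype V] [DecidableEq V]

open Matrix in
theorem distSignlessLaplacian_mulVec (G : SimpleGraph V) (f : V → ℝ) (u : V) :
    (distSignlessLaplacian G *ᵥ f) u = ∑ v, (G.dist u v : ℝ) * (f u + f v) := by
  rw [distSignlessLaplacian, add_mulVec, Pi.add_apply, mulVec_diagonal, transmission]
  simp [distMatrix, mulVec, dotProduct, mul_add, Finset.sum_add_distrib, Finset.sum_mul]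

open Matrix in
theorem exists_pos_eigenvector_eta {G : SimpleGraph V} (hG : G.Connected) :
    ∃ v : V → ℝ, (∀ i, 0 < v i) ∧ distSignlessLaplacian G *ᵥ v = eta G • v := by
  have := hG.nonempty
  refine exists_pos_eigenvector (distSignlessLaplacian_isHermitian G) ?_ ?_ (isGreatest_eta G)
  · intro i
    simp only [distSignlessLaplacian, distMatrix, Matrix.add_apply, diagonal_apply_eq, of_apply,
      transmission]
    positivity
  · intro i j hij
    simpa [distSignlessLaplacian, distMatrix, hij] using hG.pos_dist_of_ne hij

open Matrix in
/-- Pairing with a positive eigenvector turns a test vector `w` with residual `Q w - θ w` into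
information on the position of `η` relative to `θ`. -/
theorem exists_pos_eta_sub_mul {G : SimpleGraph V} (hG : G.Connected) :
    ∃ v : V → ℝ, (∀ i, 0 < v i) ∧ ∀ (w : V → ℝ) (θ : ℝ),
      (eta G - θ) * (v ⬝ᵥ w) = v ⬝ᵥ (distSignlessLaplacian G *ᵥ w - θ • w) := by
  obtain ⟨v, hv, hQ⟩ := exists_pos_eigenvector_eta hG
  refine ⟨v, hv, fun w θ => ?_⟩
  have hsymm : (distSignlessLaplacian G)ᵀ = distSignlessLaplacian G := by
    simpa using (distSignlessLaplacian_isHermitian G).eq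
  rw [dotProduct_sub, dotProduct_mulVec, ← mulVec_transpose, hsymm, hQ, smul_dotProduct,
    dotProduct_smul, smul_eq_mul, smul_eq_mul, sub_mul]

open Matrix in
/-- The row sums of `Q` are twice the transmissions, hence at least `2 * (n - 1)`; the test vector is
`1`. -/
theorem two_mul_card_sub_one_le_eta {G : SimpleGraph V} (hG : G.Connected) :
    2 * ((Fintype.card V : ℝ) - 1) ≤ eta G := by
  have := hG.nonempty
  obtain ⟨v, hv, h⟩ := exists_pos_eta_sub_mul hG
  specialize h (fun _ => 1) (2 * ((Fintype.card V : ℝ) - 1))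
  have hpos : 0 < v ⬝ᵥ fun _ => (1 : ℝ) :=
    Finset.sum_pos (fun i _ => by simpa using hv i) Finset.univ_nonempty
  have hres : 0 ≤ v ⬝ᵥ (distSignlessLaplacian G *ᵥ (fun _ => (1 : ℝ)) -
      (2 * ((Fintype.card V : ℝ) - 1)) • fun _ => (1 : ℝ)) := by
    refine Finset.sum_nonneg fun u _ => mul_nonneg (hv u).le ?_
    have h1 : (Fintype.card V : ℝ) - 1 ≤ ∑ w, (G.dist u w : ℝ) := by
      have h2 : ∑ w, (1 - if w = u then (1 : ℝ) else 0) ≤ ∑ w, (G.dist u w : ℝ) := by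
        refine Finset.sum_le_sum fun w _ => ?_
        split_ifs with hwu
        · simp
        · have := hG.pos_dist_of_ne (Ne.symm hwu)
          have : (1 : ℝ) ≤ G.dist u w := by exact_mod_cast this
          linarith
      simpa [Finset.sum_sub_distrib] using h2
    rw [Pi.sub_apply, distSignlessLaplacian_mulVec, ← Finset.sum_mul]
    simp only [Pi.smul_apply, smul_eq_mul]
    linarith
  rw [← h] at hres
  linarith [nonneg_of_mul_nonneg_left hres hpos]

open Matrix in
/-- Adding edges to a connected graph strictly decreases `η`. -/
theorem eta_lt_of_lt {G H : SimpleGraph V} (hG : G.Connected) (hlt : G < H) : eta H < eta G := by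
  have hH : H.Connected := hG.mono hlt.le
  obtain ⟨w, hw, hQw⟩ := exists_pos_eigenvector_eta hH
  obtain ⟨v, hv, h⟩ := exists_pos_eta_sub_mul hG
  specialize h w (eta H)
  have hle : ∀ x y, (H.dist x y : ℝ) ≤ G.dist x y := fun x y =>
    by exact_mod_cast (hG.preconnected x y).dist_anti hlt.le
  obtain ⟨a, b, hab, hab'⟩ : ∃ a b, H.Adj a b ∧ ¬ G.Adj a b := by
    by_contra! hcon
    exact hlt.not_ge fun a b => hcon a b
  have hres : ∀ u, (distSignlessLaplacian G *ᵥ w - eta H • w) u =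
      ∑ x, ((G.dist u x : ℝ) - H.dist u x) * (w u + w x) := by
    intro u
    rw [← hQw, Pi.sub_apply, distSignlessLaplacian_mulVec, distSignlessLaplacian_mulVec,
      ← Finset.sum_sub_distrib]
    simp only [sub_mul]
  have hterm : ∀ u x, 0 ≤ ((G.dist u x : ℝ) - H.dist u x) * (w u + w x) := fun u x =>
    mul_nonneg (sub_nonneg.2 (hle u x)) (add_pos (hw u) (hw x)).le
  have hpos : 0 < v ⬝ᵥ (distSignlessLaplacian G *ᵥ w - eta H • w) := by
    refine Finset.sum_pos' (fun u _ => mul_nonneg (hv u).le ?_)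
      ⟨a, Finset.mem_univ a, mul_pos (hv a) ?_⟩
    · rw [hres]
      exact Finset.sum_nonneg fun x _ => hterm u x
    · rw [hres]
      refine Finset.sum_pos' (fun x _ => hterm a x) ⟨b, Finset.mem_univ b, ?_⟩
      refine mul_pos (sub_pos.2 ?_) (add_pos (hw a) (hw b))
      rw [dist_eq_one_iff_adj.2 hab]
      exact_mod_cast hG.one_lt_dist_of_ne_of_not_adj hab.ne hab'
  rw [← h] at hpos
  have hvw : 0 ≤ v ⬝ᵥ w := Finset.sum_nonneg fun i _ => (mul_pos (hv i) (hw i)).le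
  linarith [pos_of_mul_pos_left hpos hvw]

end Perron

/-! ### The graphs `K_s ∨ (K_a + \overline{K_b})` -/

/-- The graph `K_s ∨ (K_a + \overline{K_b})` on a vertex set whose members are coloured `0`, `1`
and `2` according to the three parts: two distinct vertices are adjacent unless one of them has
colour `2` and the other a nonzero colour. -/
def colorGraph {V : Type*} (c : V → Fin 3) : SimpleGraph V where
  Adj u v := u ≠ v ∧ (c u = 0 ∨ c v = 0 ∨ (c u = 1 ∧ c v = 1))
  symm := ⟨fun u v h => ⟨h.1.symm, by tauto⟩⟩
  loopless := ⟨fun u h => h.1 rfl⟩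

theorem colorGraph_adj {V : Type*} {c : V → Fin 3} {u v : V} :
    (colorGraph c).Adj u v ↔ u ≠ v ∧ (c u = 0 ∨ c v = 0 ∨ (c u = 1 ∧ c v = 1)) :=
  Iff.rfl

/-- Colour-preserving bijections are isomorphisms, and they exist as soon as the colour classes
have the same sizes. -/
theorem colorGraph_iso {V W : Type*} [Fintype V] [Fintype W] {c : V → Fin 3} {d : W → Fin 3}
    (h : ∀ i, (Finset.univ.filter fun v => c v = i).card =
      (Finset.univ.filter fun w => d w = i).card) :
    Nonempty (colorGraph c ≃g colorGraph d) := by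
  have hfib : ∀ i, Nonempty ({v // c v = i} ≃ {w // d w = i}) := fun i =>
    ⟨Fintype.equivOfCardEq (by rw [Fintype.card_subtype, Fintype.card_subtype, h])⟩
  let e := fun i => (hfib i).some
  let E : V ≃ W := (Equiv.sigmaFiberEquiv c).symm.trans
    ((Equiv.sigmaCongrRight e).trans (Equiv.sigmaFiberEquiv d))
  have hE : ∀ v, d (E v) = c v := fun v => (e (c v) ⟨v, rfl⟩).2
  exact ⟨⟨E, by intro u v; simp [colorGraph_adj, hE]⟩⟩

/-- The distance between two distinct vertices of a `colorGraph` in terms of their colours. -/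
def colorDist (i j : Fin 3) : ℝ := if i = 0 ∨ j = 0 ∨ (i = 1 ∧ j = 1) then 1 else 2

theorem colorGraph_connected {V : Type*} {c : V → Fin 3} {x : V} (hx : c x = 0) :
    (colorGraph c).Connected := by
  have hreach : ∀ v, (colorGraph c).Reachable x v := fun v => by
    rcases eq_or_ne x v with rfl | h
    · exact Reachable.refl _
    · exact Adj.reachable ⟨h, Or.inl hx⟩
  exact (connected_iff _).2 ⟨fun u v => (hreach u).symm.trans (hreach v), ⟨x⟩⟩

theorem colorGraph_dist {V : Type*} {c : V → Fin 3} {x : V} (hx : c x = 0) {u v : V}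
    (huv : u ≠ v) : ((colorGraph c).dist u v : ℝ) = colorDist (c u) (c v) := by
  by_cases hadj : (colorGraph c).Adj u v
  · rw [dist_eq_one_iff_adj.2 hadj, colorDist, if_pos hadj.2, Nat.cast_one]
  · have hcol : ¬ (c u = 0 ∨ c v = 0 ∨ (c u = 1 ∧ c v = 1)) := fun h => hadj ⟨huv, h⟩
    have hux : (colorGraph c).Adj u x := ⟨by rintro rfl; tauto, by tauto⟩
    have hxv : (colorGraph c).Adj x v := ⟨by rintro rfl; tauto, by tauto⟩
    have h2 : (colorGraph c).dist u v ≤ 2 := dist_le (Walk.cons hux (Walk.cons hxv Walk.nil))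
    have h1 := (colorGraph_connected hx).one_lt_dist_of_ne_of_not_adj huv hadj
    rw [colorDist, if_neg hcol]
    exact_mod_cast (by omega : (colorGraph c).dist u v = 2)

/-- The characteristic polynomial, at `2 * n - 2 + t`, of the quotient matrix of `Q` for the
partition of `K_s ∨ (K_a + \overline{K_{s+1}})`, of order `n`, into its three parts; here
`a = n - 2 * s - 1`. The arguments are real, so that convexity in `s` can be used. -/
def quotientPoly (n s t : ℝ) : ℝ :=
  (t + n - s) * (t ^ 2 - s ^ 2 - 4 * (n - 2 * s - 1) * (s + 1)) -
    s * ((n - 2 * s - 1) * (t + s + 2) + (s + 1) * (2 * (n - 2 * s - 1) + t + s))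

open Matrix in
theorem colorGraph_mulVec_comp {V : Type*} [Fintype V] [DecidableEq V] {c : V → Fin 3} {x : V}
    (hx : c x = 0) (W : Fin 3 → ℝ) (u : V) :
    (distSignlessLaplacian (colorGraph c) *ᵥ (W ∘ c)) u =
      ∑ j, ((Finset.univ.filter fun v => c v = j).card : ℝ) *
        (colorDist (c u) j * (W (c u) + W j)) - colorDist (c u) (c u) * (2 * W (c u)) := by
  rw [distSignlessLaplacian_mulVec, eq_sub_iff_add_eq]
  have h1 : ∑ j, ((Finset.univ.filter fun v => c v = j).card : ℝ) *
      (colorDist (c u) j * (W (c u) + W j)) =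
      ∑ v, colorDist (c u) (c v) * (W (c u) + W (c v)) := by
    rw [← Finset.sum_fiberwise (s := Finset.univ) (g := c)]
    refine Finset.sum_congr rfl fun j _ => ?_
    rw [← nsmul_eq_mul, ← Finset.sum_const]
    refine Finset.sum_congr rfl fun v hv => ?_
    rw [(Finset.mem_filter.1 hv).2]
  rw [h1, ← Finset.add_sum_erase _ _ (Finset.mem_univ u),
    ← Finset.add_sum_erase _ (fun v => colorDist (c u) (c v) * (W (c u) + W (c v)))
      (Finset.mem_univ u)]
  have h2 : ∑ v ∈ Finset.univ.erase u,
        ((colorGraph c).dist u v : ℝ) * ((W ∘ c) u + (W ∘ c) v) =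
      ∑ v ∈ Finset.univ.erase u, colorDist (c u) (c v) * (W (c u) + W (c v)) := by
    refine Finset.sum_congr rfl fun v hv => ?_
    rw [colorGraph_dist hx (Finset.ne_of_mem_erase hv).symm]
    rfl
  rw [h2, SimpleGraph.dist_self]
  push_cast
  ring

/-- A colouring with `s ≥ 1` vertices of colour `0` and `s + 1` vertices of colour `2`: removing the
former from `colorGraph c` leaves more than `s` isolated vertices. -/
structure IsDeficient {V : Type*} [Fintype V] (c : V → Fin 3) (s : ℕ) : Prop where
  pos : 1 ≤ s
  card_zero : (Finset.univ.filter fun v => c v = 0).card = s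
  card_two : (Finset.univ.filter fun v => c v = 2).card = s + 1

theorem sum_card_color {V : Type*} [Fintype V] (c : V → Fin 3) :
    (Finset.univ.filter fun v => c v = 0).card +
    (Finset.univ.filter fun v => c v = 1).card + (Finset.univ.filter fun v => c v = 2).card =
      Fintype.card V := by
  rw [← Finset.card_univ (α := V), ← Fin.sum_univ_three
    fun i => (Finset.univ.filter fun v => c v = i).card]
  exact (Finset.card_eq_sum_card_fiberwise (by simp)).symm

theorem IsDeficient.exists_zero {V : Type*} [Fintype V] {c : V → Fin 3} {s : ℕ}
    (h : IsDeficient c s) : ∃ x, c x = 0 := by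
  have h0 : 0 < (Finset.univ.filter fun v => c v = 0).card := h.card_zero ▸ h.pos
  obtain ⟨x, hx⟩ := Finset.card_pos.1 h0
  exact ⟨x, (Finset.mem_filter.1 hx).2⟩

theorem IsDeficient.le_card {V : Type*} [Fintype V] {c : V → Fin 3} {s : ℕ}
    (h : IsDeficient c s) :
    2 * s + 1 ≤ Fintype.card V := by
  have := sum_card_color c
  have := h.card_zero
  have := h.card_two
  omega

open Matrix in
/-- The sign of `2 * n - 2 + t - η` is that of `quotientPoly n s t`. The test vector solves the
eigenvalue equations for the colours `0` and `1`, and is positive for `0 ≤ t`. -/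
theorem IsDeficient.eta_sub_mul {V : Type*} [Fintype V] [DecidableEq V] {c : V → Fin 3} {s : ℕ}
    (h : IsDeficient c s) {t : ℝ} (ht : 0 ≤ t) : ∃ α β : ℝ, 0 < α ∧ 0 < β ∧
      (eta (colorGraph c) - (2 * Fintype.card V - 2 + t)) * α =
        -(quotientPoly (Fintype.card V) s t * β) := by
  obtain ⟨x, hx⟩ := h.exists_zero
  obtain ⟨v, hv, hQ⟩ := exists_pos_eta_sub_mul (colorGraph_connected hx)
  have hcard := sum_card_color c
  rw [h.card_zero, h.card_two] at hcard
  set n : ℝ := (Fintype.card V : ℝ) with hn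
  set a : ℝ := ((Finset.univ.filter fun v => c v = 1).card : ℝ) with ha
  have hN : (s : ℝ) + a + (s + 1) = n := by rw [ha, hn]; exact_mod_cast hcard
  have ha0 : 0 ≤ a := by positivity
  have hs : (1 : ℝ) ≤ s := by exact_mod_cast h.pos
  -- the cofactors of the last row of the matrix `2 * n - 2 + t` minus the quotient matrix
  let W : Fin 3 → ℝ := ![(s + 1) * (2 * a + t + s), (s + 1) * (2 * (t + n - s) + s),
    (t + n - s) * (t + s) - s * a]
  have hns : 0 < n - s := by linarith
  have hW : ∀ i, 0 < W i := by
    intro i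
    fin_cases i
    · change 0 < ((s : ℝ) + 1) * (2 * a + t + s)
      positivity
    · change 0 < ((s : ℝ) + 1) * (2 * (t + n - s) + s)
      exact mul_pos (by linarith) (by linarith)
    · change 0 < (t + n - s) * (t + s) - s * a
      have : (t + n - s) * (t + s) - s * a = t * (t + n) + s * (s + 1) := by
        rw [← hN]; ring
      rw [this]
      nlinarith [mul_nonneg ht (by linarith : 0 ≤ t + n)]
  have hres : ∀ u, (distSignlessLaplacian (colorGraph c) *ᵥ (W ∘ c) -
      (2 * n - 2 + t) • (W ∘ c)) u = -quotientPoly n s t * if c u = 2 then 1 else 0 := by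
    intro u
    rw [Pi.sub_apply, colorGraph_mulVec_comp hx, Fin.sum_univ_three, h.card_zero, h.card_two, ← ha]
    simp only [Pi.smul_apply, Function.comp_apply, smul_eq_mul, colorDist, quotientPoly]
    have ha' : a = n - 2 * s - 1 := by linarith
    generalize c u = i
    fin_cases i <;> simp [W] <;> rw [ha'] <;> ring
  refine ⟨v ⬝ᵥ (W ∘ c), v ⬝ᵥ fun u => if c u = 2 then 1 else 0, ?_, ?_, ?_⟩
  · exact Finset.sum_pos (fun u _ => mul_pos (hv u) (hW _)) ⟨x, Finset.mem_univ x⟩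
  · have h2 : 0 < (Finset.univ.filter fun v => c v = 2).card := by rw [h.card_two]; omega
    obtain ⟨y, hy⟩ := Finset.card_pos.1 h2
    refine Finset.sum_pos' (fun u _ => mul_nonneg (hv u).le (by positivity))
      ⟨y, Finset.mem_univ y, ?_⟩
    simpa [(Finset.mem_filter.1 hy).2] using hv y
  · rw [hQ, show distSignlessLaplacian (colorGraph c) *ᵥ (W ∘ c) - (2 * n - 2 + t) • (W ∘ c) = _
      from funext hres, dotProduct, dotProduct, Finset.mul_sum, ← Finset.sum_neg_distrib]
    exact Finset.sum_congr rfl fun u _ => by ring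

/-! ### The sign of the quotient polynomial -/

/-- For `0 ≤ t` the polynomial is strictly convex in `s` on `[0, n / 2]`. -/
theorem quotientPoly_neg_of_between {n t p s q : ℝ} (hn : 1 ≤ n) (ht : 0 ≤ t) (hps : p < s)
    (hsq : s < q) (hq : q ≤ n / 2) (hPp : quotientPoly n p t ≤ 0) (hPq : quotientPoly n q t ≤ 0) :
    quotientPoly n s t < 0 := by
  -- the last factor is the second divided difference of the cubic at `p`, `s`, `q`
  have key : (q - p) * quotientPoly n s t = (q - s) * quotientPoly n p t +
      (s - p) * quotientPoly n q t -
      (q - s) * (s - p) * (q - p) * (8 * t + 8 * n - 2 - 2 * (p + s + q)) := by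
    unfold quotientPoly
    ring
  have h1 := mul_nonpos_of_nonneg_of_nonpos (sub_pos.2 hsq).le hPp
  have h2 := mul_nonpos_of_nonneg_of_nonpos (sub_pos.2 hps).le hPq
  have h3 : 0 < (q - s) * (s - p) * (q - p) * (8 * t + 8 * n - 2 - 2 * (p + s + q)) := by
    refine mul_pos (mul_pos (mul_pos ?_ ?_) ?_) ?_ <;> linarith
  have h4 : (q - p) * quotientPoly n s t < 0 := by linarith
  exact neg_of_mul_neg_right h4 (by linarith)

/-- At the right end of the range the part `K_{n - 2s - 1}` disappears and the polynomial
factors. -/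
theorem quotientPoly_half (m t : ℝ) :
    quotientPoly (2 * m + 1) m t = (t + m) * (t ^ 2 + t - 2 * m * (m + 1)) := by
  unfold quotientPoly
  ring

/-- For even `n` the largest admissible `s` leaves `K_{n - 2s - 1} = K_1`, and the polynomial
factors as well. -/
theorem quotientPoly_half' (m t : ℝ) :
    quotientPoly (2 * m + 2) m t = (t + m + 2) * (t ^ 2 - 2 * (m + 1) * (m + 2)) := by
  unfold quotientPoly
  ring

theorem quotientPoly_one (n t : ℝ) :
    quotientPoly n 1 t = (t + n - 1) * (t ^ 2 - 8 * n + 23) - (n - 1) * t - 7 * n + 19 := by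
  unfold quotientPoly
  ring

/-- If `s = 1` attains the root `t`, the polynomial is negative at the right end of the range. This
real end point serves both parities of `n`. -/
theorem quotientPoly_half_neg {n t : ℝ} (hn : 16 ≤ n) (ht : 0 ≤ t)
    (h1 : quotientPoly n 1 t = 0) : quotientPoly n ((n - 1) / 2) t < 0 := by
  have hfac := quotientPoly_half ((n - 1) / 2) t
  rw [show 2 * ((n - 1) / 2) + 1 = n by ring] at hfac
  rw [hfac]
  refine mul_neg_of_pos_of_neg (by linarith) ?_
  by_contra! hcon
  -- otherwise `t` is at least about `n / √2`, where `quotientPoly n 1` is positive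
  have hL : 0.7 * n - 0.4 ≤ t := by
    by_contra! hlt
    nlinarith
  obtain ⟨u, hu, rfl⟩ : ∃ u, 0 ≤ u ∧ t = 0.7 * n - 0.4 + u :=
    ⟨t - (0.7 * n - 0.4), by linarith, by ring⟩
  obtain ⟨k, hk, rfl⟩ : ∃ k, 0 ≤ k ∧ n = 16 + k := ⟨n - 16, by linarith, by ring⟩
  -- in `u` and `k` the polynomial has positive coefficients
  refine h1.not_gt ?_
  rw [quotientPoly_one]
  ring_nf
  positivity

/-- `s₀` is the only minimizer of `η` among the graphs `K_s ∨ (K_{n-2s-1} + \overline{K_{s+1}})`,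
expressed by the sign of `quotientPoly`: at the root `t` that belongs to `s₀`, it is negative for the
other admissible `s`. -/
def IsMinimizing (n s₀ : ℕ) : Prop :=
  ∀ (s : ℕ) (t : ℝ), 1 ≤ s → 2 * s + 1 ≤ n → s ≠ s₀ → 0 ≤ t →
    quotientPoly n s₀ t = 0 → quotientPoly n s t < 0

theorem isMinimizing_one {n : ℕ} (hn : 16 ≤ n ∨ n = 12 ∨ n = 14) : IsMinimizing n 1 := by
  intro s t hs1 hsn hne ht h1
  have hs : (1 : ℝ) < s := by exact_mod_cast (by omega : 1 < s)
  rw [Nat.cast_one] at h1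
  -- it suffices to find a right end point at which the polynomial is negative
  have main : ∀ q : ℝ, (s : ℝ) ≤ q → q ≤ n / 2 → quotientPoly n q t < 0 →
      quotientPoly n s t < 0 := by
    intro q hsq hqn hq
    rcases hsq.eq_or_lt with rfl | h
    · exact hq
    · exact quotientPoly_neg_of_between (by exact_mod_cast (by omega : 1 ≤ n)) ht hs h hqn h1.le
        hq.le
  have hsn' : (2 * s + 1 : ℝ) ≤ n := by exact_mod_cast hsn
  rcases hn with hn | rfl | rfl
  · exact main ((n - 1) / 2) (by linarith) (by linarith)
      (quotientPoly_half_neg (by exact_mod_cast hn) ht h1)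
  · have h5 : s ≤ 5 := by omega
    refine main 5 (by exact_mod_cast h5) (by norm_num) ?_
    have hfac := quotientPoly_half' 5 t
    norm_num [quotientPoly_one] at h1 hfac ⊢
    rw [hfac]
    refine mul_neg_of_pos_of_neg (by linarith) ?_
    by_contra! hcon
    nlinarith
  · have h6 : s ≤ 6 := by omega
    refine main 6 (by exact_mod_cast h6) (by norm_num) ?_
    have hfac := quotientPoly_half' 6 t
    norm_num [quotientPoly_one] at h1 hfac ⊢
    rw [hfac]
    refine mul_neg_of_pos_of_neg (by linarith) ?_
    by_contra! hcon
    nlinarith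

theorem isMinimizing_half {n : ℕ} (hn : (3 ≤ n ∧ n ≤ 11) ∨ n = 13 ∨ n = 15) :
    IsMinimizing n ((n - 1) / 2) := by
  intro s t hs1 hsn hne ht hm
  have hn3 : 3 ≤ n := by omega
  have hsm : s < (n - 1) / 2 := by omega
  have hone : quotientPoly n 1 t < 0 := by
    have hn5 : 5 ≤ n := by omega
    rw [quotientPoly_one]
    rcases Nat.even_or_odd' n with ⟨k, rfl | rfl⟩
    · obtain ⟨m, rfl⟩ : ∃ m, k = m + 1 := ⟨k - 1, by omega⟩
      rw [show (2 * (m + 1) - 1) / 2 = m by omega] at hm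
      push_cast [mul_add] at hm
      rw [quotientPoly_half', mul_eq_zero, or_iff_right (by positivity)] at hm
      have hm4 : m ≤ 4 := by omega
      have hm2 : 2 ≤ m := by omega
      interval_cases m <;> norm_num at hm ⊢ <;> nlinarith
    · rw [show (2 * k + 1 - 1) / 2 = k by omega] at hm
      push_cast at hm ⊢
      rw [quotientPoly_half, mul_eq_zero, or_iff_right] at hm
      · have hk7 : k ≤ 7 := by omega
        have hk2 : 2 ≤ k := by omega
        interval_cases k <;> norm_num at hm ⊢ <;> nlinarith
      · have : (0 : ℝ) < k := by exact_mod_cast (by omega : 0 < k)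
        positivity
  rcases hs1.eq_or_lt with rfl | hs
  · simpa using hone
  · refine quotientPoly_neg_of_between (by exact_mod_cast (by omega : 1 ≤ n)) ht
      (by exact_mod_cast hs) (Nat.cast_lt.2 hsm) ?_ hone.le hm.le
    have : (2 * ((n - 1) / 2 : ℕ) : ℝ) ≤ n := by exact_mod_cast (by omega : 2 * ((n - 1) / 2) ≤ n)
    linarith

/-! ### Comparison with the extremal graphs -/

/-- A connected graph without a factor is a spanning subgraph of one of the graphs
`K_s ∨ (K_{n-2s-1} + \overline{K_{s+1}})`. -/
theorem exists_isDeficient_of_not_hasFactor {V : Type*} [Fintype V] [DecidableEq V]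
    {G : SimpleGraph V} (hG : G.Connected) (hV : 2 ≤ Fintype.card V)
    (h : ¬ HasFactor G edgeOrCycles) :
    ∃ (c : V → Fin 3) (s : ℕ), IsDeficient c s ∧ G ≤ colorGraph c := by
  obtain ⟨S, I, hdisj, hcard, hSI⟩ := exists_independent_of_not_hasFactor h
  have hIS : ∀ v ∈ I, v ∉ S := fun v hI hS => Finset.disjoint_left.1 hdisj hS hI
  refine ⟨fun v => if v ∈ S then 0 else if v ∈ I then 2 else 1, S.card, ⟨?_, ?_, ?_⟩, ?_⟩
  · obtain ⟨u, hu⟩ := Finset.card_pos.1 (by omega : 0 < I.card)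
    have : Nontrivial V := Fintype.one_lt_card_iff_nontrivial.1 hV
    obtain ⟨v, huv⟩ := hG.preconnected.exists_adj_of_nontrivial u
    exact Finset.card_pos.2 ⟨v, hSI u hu v huv⟩
  · congr 1
    ext v
    simp only [Finset.mem_filter_univ]
    split_ifs <;> simp_all
  · rw [← hcard]
    congr 1
    ext v
    have hv := hIS v
    simp only [Finset.mem_filter_univ]
    split_ifs <;> simp <;> tauto
  · intro u v huv
    refine ⟨huv.ne, ?_⟩
    have h1 := fun hu => hSI u hu v huv
    have h2 := fun hv => hSI v hv u huv.symm
    dsimp only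
    split_ifs <;> simp_all

/-- If `s₀` minimizes `η` in the family, only the corresponding graph is exceptional: a graph without
a factor lies below a member of the family, whose `η` is at least that for `s₀`, and equality in
both comparisons forces an isomorphism. -/
theorem hasFactor_of_eta_le {V W : Type*} [Fintype V] [DecidableEq V] [Fintype W] [DecidableEq W]
    {G : SimpleGraph V} (hG : G.Connected) {n s₀ : ℕ} (hn : Fintype.card V = n) (hn2 : 2 ≤ n)
    (hW : Fintype.card W = n) {d : W → Fin 3} (hd : IsDeficient d s₀) (hmin : IsMinimizing n s₀)
    (hle : eta G ≤ eta (colorGraph d)) (hiso : ¬ Nonempty (G ≃g colorGraph d)) :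
    HasFactor G edgeOrCycles := by
  by_contra hfac
  obtain ⟨c, s, hc, hGc⟩ := exists_isDeficient_of_not_hasFactor hG (hn ▸ hn2) hfac
  obtain ⟨x, hx⟩ := hd.exists_zero
  set t : ℝ := eta (colorGraph d) - (2 * n - 2) with htdef
  have ht : 0 ≤ t := by
    have := two_mul_card_sub_one_le_eta (colorGraph_connected hx)
    rw [hW] at this
    linarith
  have hθ : 2 * (n : ℝ) - 2 + t = eta (colorGraph d) := by rw [htdef]; ring
  have h0 : quotientPoly n s₀ t = 0 := by
    obtain ⟨α, β, -, hβ, h⟩ := hd.eta_sub_mul ht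
    rw [hW, hθ, sub_self, zero_mul, eq_comm, neg_eq_zero] at h
    exact (mul_eq_zero.1 h).resolve_right hβ.ne'
  obtain ⟨α, β, hα, hβ, h⟩ := hc.eta_sub_mul ht
  rw [hn, hθ] at h
  have hcG : eta (colorGraph c) ≤ eta G := by
    rcases hGc.eq_or_lt with rfl | hlt
    exacts [le_rfl, (eta_lt_of_lt hG hlt).le]
  rcases eq_or_ne s s₀ with rfl | hne
  · rw [h0, zero_mul, neg_zero, mul_eq_zero, or_iff_left hα.ne', sub_eq_zero] at h
    rcases hGc.eq_or_lt with rfl | hlt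
    · refine hiso (colorGraph_iso fun i => ?_)
      have h1 := sum_card_color c
      have h2 := sum_card_color d
      have := hc.card_zero
      have := hc.card_two
      have := hd.card_zero
      have := hd.card_two
      fin_cases i <;> simp only [Fin.zero_eta, Fin.mk_one, Fin.reduceFinMk] <;> omega
    · have := eta_lt_of_lt hG hlt
      linarith
  · have hneg := hmin s t hc.pos (hn ▸ hc.le_card) hne ht h0
    have h1 : 0 < (eta (colorGraph c) - eta (colorGraph d)) * α := by
      rw [h]
      exact neg_pos.2 (mul_neg_of_neg_of_pos hneg hβ)
    have := pos_of_mul_pos_left h1 hα.le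
    linarith

/-- The parts of `oneJoin n`, as colours. -/
def oneJoinColor (n : ℕ) : Fin 1 ⊕ (Fin (n - 3) ⊕ Fin 2) → Fin 3 :=
  Sum.elim (fun _ => 0) (Sum.elim (fun _ => 1) fun _ => 2)

/-- The parts of `halfJoin n`, as colours. For even `n`, one vertex of the independent part plays
the role of the clique `K_{n-2s-1} = K_1`. -/
def halfJoinColor (n : ℕ) : Fin ((n - 1) / 2) ⊕ Fin (n / 2 + 1) → Fin 3 :=
  Sum.elim (fun _ => 0) fun j => if Even n ∧ j = 0 then 1 else 2

theorem oneJoin_eq_colorGraph (n : ℕ) : oneJoin n = colorGraph (oneJoinColor n) := by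
  ext u v
  rcases u with u | u | u <;> rcases v with v | v | v <;>
    simp [oneJoin, join, colorGraph_adj, oneJoinColor, completeGraph, eq_iff_true_of_subsingleton]

theorem halfJoin_eq_colorGraph (n : ℕ) : halfJoin n = colorGraph (halfJoinColor n) := by
  ext u v
  rcases u with u | u <;> rcases v with v | v <;>
    simp [halfJoin, join, colorGraph_adj, halfJoinColor, completeGraph]
  grind

theorem oneJoinColor_isDeficient (n : ℕ) : IsDeficient (oneJoinColor n) 1 := by
  refine ⟨le_rfl, ?_, ?_⟩ <;> rw [Finset.card_filter, Fintype.sum_sum_type, Fintype.sum_sum_type] <;>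
    simp [oneJoinColor]

theorem halfJoinColor_isDeficient {n : ℕ} (hn : 3 ≤ n) :
    IsDeficient (halfJoinColor n) ((n - 1) / 2) := by
  refine ⟨by omega, ?_, ?_⟩ <;> rw [Finset.card_filter, Fintype.sum_sum_type]
  · simp only [halfJoinColor, Sum.elim_inl, Sum.elim_inr]
    rw [Finset.sum_eq_zero (s := Finset.univ (α := Fin (n / 2 + 1)))]
    · simp
    · intro j _
      split_ifs <;> simp_all
  · simp only [halfJoinColor, Sum.elim_inl, Sum.elim_inr, Fin.sum_univ_succ]
    by_cases he : Even n
    · obtain ⟨k, rfl⟩ := he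
      simp [Fin.succ_ne_zero]
      omega
    · have := Nat.not_even_iff.1 he
      simp [he]
      omega

end DistanceSignless

theorem theorem2 {V : Type*} [Fintype V] [DecidableEq V] (G : SimpleGraph V)
    (hG : G.Connected) (n : ℕ) (hn : Fintype.card V = n) :
    ((16 ≤ n ∨ n = 12 ∨ n = 14) →
      DistanceSignless.eta G ≤ DistanceSignless.eta (DistanceSignless.oneJoin n) →
      ¬ Nonempty (G ≃g DistanceSignless.oneJoin n) →
      DistanceSignless.HasFactor G DistanceSignless.edgeOrCycles) ∧
    (((3 ≤ n ∧ n ≤ 11) ∨ n = 13 ∨ n = 15) →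
      DistanceSignless.eta G ≤ DistanceSignless.eta (DistanceSignless.halfJoin n) →
      ¬ Nonempty (G ≃g DistanceSignless.halfJoin n) →
      DistanceSignless.HasFactor G DistanceSignless.edgeOrCycles) := by
  open DistanceSignless in
  rw [oneJoin_eq_colorGraph, halfJoin_eq_colorGraph]
  refine ⟨fun hcase => ?_, fun hcase => ?_⟩
  · exact hasFactor_of_eta_le hG hn (by omega) (by simp; omega) (oneJoinColor_isDeficient n)
      (isMinimizing_one hcase)
  · exact hasFactor_of_eta_le hG hn (by omega) (by simp; omega)
      (halfJoinColor_isDeficient (by omega)) (isMinimizing_half hcase)
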